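/- Let $K$ be a field with the discrete topology. A Hausdorff topological $K$-vector space is \emph{linearly topologized} if it has a neighborhood basis at $0$ consisting of linear subspaces. It is \emph{linearly compact} if it is linearly topologized and every collection of closed linear varieties (cosets $v+W$ of closed linear subspaces $W$) with the finite intersection property has non-empty intersection. A topological $K$-vector space $V$ is \emph{locally linearly compact} (l.l.c.) if the family $\mathcal B(V)$ of all open linear subspaces of $V$ that are linearly compact in the induced topology is a neighborhood basis at $0$. For a continuous linear endomorphism $\phi$ of an l.l.c. space $V$ and $U\in\mathcal B(V)$, put $T_n(\phi,U)=U+\phi U+\dots+\phi^{n-1}U$ and $$H(\phi,U)=\lim_{n\to\infty}\frac1n\dim_K\frac{T_n(\phi,U)}{U},\qquad \mathrm{ent}(\phi)=\sup\{H(\phi,U)\mid U\in\mathcal B(V)\}\in[0,\infty].$$ \textbf{Corollary (Addition Theorem for the algebraic entropy).} Let $V$ be an l.l.c. space over $K$, $\phi:V\to V$ a continuous linear endomorphism, $W$ a closed linear subspace of $V$ with $\phi W\subseteq W$, $\phi|_W:W\to W$ the restriction of $\phi$ to $W$ (with the induced topology), and $\overline\phi:V/W\to V/W$ the endomorphism of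 $V/W$ (with the quotient topology) induced by $\phi$. Then $$\mathrm{ent}(\phi)=\mathrm{ent}(\phi|_W)+\mathrm{ent}(\overline\phi).$$ -/

import Mathlib

open Filter Topology
open scoped ENNReal Pointwise

namespace LinTop

section Spaces

variable (K : Type*) [Field K] {V : Type*} [AddCommGroup V] [Module K V] [TopologicalSpace V]

/-- A closed linear variety of `V`: a coset `v + W` of a closed linear subspace `W`. -/
def IsClosedLinearVariety (s : Set V) : Prop :=
  ∃ (v : V) (W : Submodule K V), IsClosed (W : Set V) ∧ s = v +ᵥ (W : Set V)

variable (V) in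
/-- A linearly compact space over the (discrete) field `K`: a linearly topologized Hausdorff
topological vector space in which every collection of closed linear varieties with the finite
intersection property has non-empty intersection. -/
structure IsLinearlyCompact : Prop where
  t2 : T2Space V
  addGroup : IsTopologicalAddGroup V
  smul : ContinuousConstSMul K V
  linear : IsLinearTopology K V
  fip : ∀ S : Set (Set V), (∀ s ∈ S, IsClosedLinearVariety K s) →
    (∀ F ⊆ S, F.Finite → (⋂₀ F).Nonempty) → (⋂₀ S).Nonempty

variable (V) in
/-- The family `𝓑(V)` of all linearly compact (in the induced topology) open linear subspaces
of `V`. -/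
def openLC : Set (Submodule K V) :=
  {U | IsOpen (U : Set V) ∧ IsLinearlyCompact K U}

variable (V) in
/-- `V` is locally linearly compact: the linearly compact open linear subspaces of `V` form a
neighborhood basis at `0`. -/
def IsLLC : Prop :=
  (𝓝 (0 : V)).HasBasis (fun U : Submodule K V => U ∈ openLC K V) (fun U => (U : Set V))

end Spaces

section Trajectories

variable {K : Type*} [Field K] {V : Type*} [AddCommGroup V] [Module K V]

/-- The dimension of `T / (T ∩ U)`, a natural number or `∞`; this is `dim (T / U)` if `U ≤ T`. -/
noncomputable def codim (T U : Submodule K V) : ℕ∞ :=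
  Cardinal.toENat (Module.rank K (T ⧸ U.submoduleOf T))

/-- The trajectory `T_n(φ, U) = U + φ U + … + φ^{n-1} U`. -/
def trajectory (φ : V →ₗ[K] V) (n : ℕ) (U : Submodule K V) : Submodule K V :=
  ⨆ i ∈ Finset.range n, U.map (φ ^ i)

/-- `H(φ, U) = lim_{n → ∞} (1 / n) dim (T_n(φ, U) / U)`, in `[0, ∞]`. The limit exists, see
`tendsto_entAt`. -/
noncomputable def entAt (φ : V →ₗ[K] V) (U : Submodule K V) : ℝ≥0∞ :=
  limUnder atTop (fun n : ℕ => (codim (trajectory φ n U) U : ℝ≥0∞) / n)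

lemma trajectory_le_iff (φ : V →ₗ[K] V) (n : ℕ) (U T : Submodule K V) :
    trajectory φ n U ≤ T ↔ ∀ i < n, U.map (φ ^ i) ≤ T := by
  simp [trajectory]

lemma map_pow_le_trajectory (φ : V →ₗ[K] V) {i n : ℕ} (h : i < n) (U : Submodule K V) :
    U.map (φ ^ i) ≤ trajectory φ n U :=
  (trajectory_le_iff φ n U _).1 le_rfl i h

lemma codim_eq_map (T U : Submodule K V) :
    codim T U = Cardinal.toENat (Module.rank K (T.map U.mkQ)) := by
  have e : (T ⧸ U.submoduleOf T) ≃ₗ[K] LinearMap.range (U.mkQ ∘ₗ T.subtype) :=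
    (Submodule.quotEquivOfEq _ _ (by
      ext x
      simp [Submodule.submoduleOf])).trans (LinearMap.quotKerEquivRange _)
  rw [codim, e.rank_eq, LinearMap.range_comp, Submodule.range_subtype]

lemma codim_mono {T T' : Submodule K V} (U : Submodule K V) (h : T ≤ T') :
    codim T U ≤ codim T' U := by
  rw [codim_eq_map, codim_eq_map]
  exact OrderHomClass.mono _ (Submodule.rank_mono (Submodule.map_mono h))

lemma codim_trajectory_add (φ : V →ₗ[K] V) (U : Submodule K V) (n m : ℕ) :
    codim (trajectory φ (n + m + 1) U) U ≤
      codim (trajectory φ (n + 1) U) U + codim (trajectory φ (m + 1) U) U := by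
  set A := trajectory φ (n + 1) U
  set B := trajectory φ (m + 1) U
  have hA : U.map (φ ^ n) ≤ A := map_pow_le_trajectory φ (Nat.lt_succ_self n) U
  have hU : U ≤ A := by
    simpa [Module.End.one_eq_id] using map_pow_le_trajectory φ (Nat.succ_pos n) U
  have hT : trajectory φ (n + m + 1) U ≤ A ⊔ B.map (φ ^ n) := by
    rw [trajectory_le_iff]
    intro i hi
    by_cases h : i < n + 1
    · exact (map_pow_le_trajectory φ h U).trans le_sup_left
    · refine le_trans ?_ le_sup_right
      obtain ⟨j, rfl⟩ := Nat.exists_eq_add_of_le (show n ≤ i by omega)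
      rw [pow_add, Module.End.mul_eq_comp, Submodule.map_comp]
      exact Submodule.map_mono (map_pow_le_trajectory φ (by omega) U)
  have key : codim (A ⊔ B.map (φ ^ n)) U ≤ codim A U + codim B U := by
    obtain ⟨C, hC⟩ := Submodule.exists_isCompl (U.submoduleOf B)
    have hBC : Module.rank K (B ⧸ U.submoduleOf B) = Module.rank K C :=
      (Submodule.quotientEquivOfIsCompl _ _ hC).rank_eq
    let f : C →ₗ[K] V := (φ ^ n) ∘ₗ B.subtype ∘ₗ C.subtype
    have hle : A ⊔ B.map (φ ^ n) ≤ A ⊔ LinearMap.range f := by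
      refine sup_le le_sup_left ?_
      rintro _ ⟨b, hb, rfl⟩
      have : (⟨b, hb⟩ : B) ∈ U.submoduleOf B ⊔ C := by rw [hC.sup_eq_top]; trivial
      obtain ⟨u, hu, c, hc, huc⟩ := Submodule.mem_sup.1 this
      have hb' : b = (u : V) + (c : V) := by
        simpa using (congrArg Subtype.val huc).symm
      rw [hb', map_add]
      exact Submodule.add_mem_sup (hA ⟨u, hu, rfl⟩) ⟨⟨c, hc⟩, rfl⟩
    refine (codim_mono U hle).trans ?_
    rw [codim_eq_map, Submodule.map_sup, codim_eq_map A, codim, hBC, ← map_add]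
    refine (OrderHomClass.mono _ (Submodule.rank_add_le_rank_add_rank _ _)).trans ?_
    refine OrderHomClass.mono _ (add_le_add le_rfl ?_)
    rw [← LinearMap.range_comp]
    exact rank_range_le _
  exact (codim_mono U hT).trans key

/-- The limit defining `entAt` exists. -/
theorem tendsto_entAt (φ : V →ₗ[K] V) (U : Submodule K V) :
    Tendsto (fun n : ℕ => (codim (trajectory φ n U) U : ℝ≥0∞) / n) atTop (𝓝 (entAt φ U)) := by
  apply tendsto_nhds_limUnder
  by_cases htop : ∃ n, codim (trajectory φ n U) U = ⊤
  · obtain ⟨n, hn⟩ := htop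
    refine ⟨⊤, tendsto_const_nhds.congr' ?_⟩
    filter_upwards [eventually_ge_atTop n] with m hm
    have : codim (trajectory φ m U) U = ⊤ := by
      refine top_le_iff.1 (hn ▸ codim_mono U ?_)
      rw [trajectory_le_iff]
      exact fun i hi => map_pow_le_trajectory φ (hi.trans_le hm) U
    rw [this]
    simp [ENNReal.top_div]
  · push Not at htop
    choose d hd using fun n => ENat.ne_top_iff_exists.1 (htop n)
    have hsub : Subadditive (fun n => (d (n + 1) : ℝ)) := by
      intro m n
      have := codim_trajectory_add φ U m n
      rw [← hd, ← hd, ← hd] at this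
      show (d (m + n + 1) : ℝ) ≤ d (m + 1) + d (n + 1)
      exact_mod_cast this
    have hlim := hsub.tendsto_lim ⟨0, by rintro _ ⟨n, rfl⟩; positivity⟩
    have hlim' : Tendsto (fun n : ℕ => (d (n + 1) : ℝ) / ((n + 1 : ℕ) : ℝ)) atTop
        (𝓝 hsub.lim) := by
      have h1 := hlim.mul (tendsto_natCast_div_add_atTop (1 : ℝ))
      rw [mul_one] at h1
      refine h1.congr' ?_
      filter_upwards [eventually_gt_atTop 0] with n hn
      have : (n : ℝ) ≠ 0 := by positivity
      push_cast
      field_simp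
    refine ⟨ENNReal.ofReal hsub.lim, ?_⟩
    rw [← tendsto_add_atTop_iff_nat 1]
    refine (ENNReal.tendsto_ofReal hlim').congr fun n => ?_
    rw [ENNReal.ofReal_div_of_pos (by positivity), ENNReal.ofReal_natCast,
      ENNReal.ofReal_natCast, ← hd]
    simp

end Trajectories

/-- The algebraic entropy `ent(φ) = sup {H(φ, U) | U ∈ 𝓑(V)}`, in `[0, ∞]`. -/
noncomputable def ent {K : Type*} [Field K] {V : Type*} [AddCommGroup V] [Module K V]
    [TopologicalSpace V] (φ : V →ₗ[K] V) : ℝ≥0∞ :=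
  ⨆ U ∈ openLC K V, entAt φ U

end LinTop

namespace LinTop

/-! Entropy is the rank of a `K[X]`-module, and rank is additive on short exact sequences.

Fix one linearly compact open `U`, a linear complement `C`, and the projection `p : V → C` along
`U`. The compression `ψ = p φ|_C` makes `C` a `K[X]`-module. As `φ` is continuous and `U` is
linearly compact, `p φ U` is finite-dimensional. For finite-dimensional `D ⊇ p φ U`, the error `p φ
- ψ p` takes values in `D`, so the entropy of `φ` at `p⁻¹ D` is that of `ψ` at `D` (`entAt_comap`).
These `p⁻¹ D` are cofinal among the linearly compact open subspaces and entropy grows with the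
subspace (`entAt_le_entAt`), so only the discrete map `ψ` matters. There the supremum is the rank of
`C` (`iSup_entAt_eq_rank`), whence `ent_eq_rank`.

Choosing `C` with `p W ⊆ W` (`exists_projection`) makes `E = W ∩ C` stable under `ψ`; the modules
attached to `W` and `V/W` are then `E` and `C/E`. -/

lemma le_of_tendsto_div_nat {a b : ℕ → ℝ≥0∞} {c x y : ℝ≥0∞} (hc : c ≠ ⊤)
    (h : ∀ᶠ n in atTop, a n ≤ b n + c)
    (ha : Tendsto (fun n : ℕ => a n / n) atTop (𝓝 x))
    (hb : Tendsto (fun n : ℕ => b n / n) atTop (𝓝 y)) : x ≤ y := by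
  have h0 : Tendsto (fun n : ℕ => c / n) atTop (𝓝 0) := by
    have := ENNReal.Tendsto.const_div ENNReal.tendsto_nat_nhds_top (Or.inr hc)
    simpa using this
  have hb' : Tendsto (fun n : ℕ => b n / n + c / n) atTop (𝓝 y) := by
    simpa using hb.add h0
  refine le_of_tendsto_of_tendsto ha hb' ?_
  filter_upwards [h] with n hn
  rw [← ENNReal.add_div]
  exact ENNReal.div_le_div_right hn _

/-! ### Entropy under change of subspace and compression -/

section Algebra

variable {K : Type*} [Field K] {V : Type*} [AddCommGroup V] [Module K V]

lemma rank_le_rank_map_add_rank_ker {V' : Type*} [AddCommGroup V'] [Module K V'] (f : V →ₗ[K] V')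
    (S : Submodule K V) :
    Cardinal.toENat (Module.rank K S) ≤ Cardinal.toENat (Module.rank K (S.map f)) +
      Cardinal.toENat (Module.rank K (LinearMap.ker f)) := by
  have h := (f.domRestrict S).lift_rank_range_add_rank_ker
  have h2 := congrArg Cardinal.toENat h
  simp only [map_add, Cardinal.toENat_lift] at h2
  rw [← h2, LinearMap.range_domRestrict]
  refine add_le_add le_rfl (OrderHomClass.mono _ ?_)
  refine LinearMap.rank_le_of_injective
    (LinearMap.restrict (p := LinearMap.ker (f.domRestrict S)) (q := LinearMap.ker f)
      S.subtype (fun x hx => hx)) ?_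
  intro x y hxy
  have := congrArg Subtype.val hxy
  exact Subtype.ext (Subtype.ext this)

lemma codim_le_codim_add_codim (A : Submodule K V) {U U' : Submodule K V} (h : U ≤ U') :
    codim A U ≤ codim A U' + codim U' U := by
  have := rank_le_rank_map_add_rank_ker (Submodule.factor h) (A.map U.mkQ)
  rwa [← Submodule.map_comp, Submodule.factor_comp_mk, Submodule.ker_mapQ, Submodule.comap_id,
    ← codim_eq_map, ← codim_eq_map, ← codim_eq_map] at this

/-- Replacing `U'` by `U` in the denominator costs only the constant `dim (U'/U)`, which disappears
after division by `n`. -/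
lemma entAt_le_entAt (φ : V →ₗ[K] V) {U U' : Submodule K V} (h : U ≤ U')
    (hfin : codim U' U ≠ ⊤) : entAt φ U ≤ entAt φ U' := by
  refine le_of_tendsto_div_nat (c := (codim U' U : ℝ≥0∞)) (by simpa using hfin)
    (.of_forall fun n => ?_) (tendsto_entAt φ U) (tendsto_entAt φ U')
  have h1 : trajectory φ n U ≤ trajectory φ n U' := by
    rw [trajectory_le_iff]
    exact fun i hi => (Submodule.map_mono h).trans (map_pow_le_trajectory φ hi U')
  have := (codim_mono U h1).trans (codim_le_codim_add_codim _ h)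
  exact_mod_cast this

lemma codim_eq_codim_map {V' : Type*} [AddCommGroup V'] [Module K V'] {p : V →ₗ[K] V'}
    (hp : Function.Surjective p) (A : Submodule K V) (D : Submodule K V') :
    codim A (D.comap p) = codim (A.map p) D := by
  let e : (V ⧸ D.comap p) ≃ₗ[K] (V' ⧸ D) :=
    LinearEquiv.ofBijective ((D.comap p).mapQ D p le_rfl)
      ⟨by
        rw [← LinearMap.ker_eq_bot, Submodule.ker_mapQ, ← LinearMap.le_ker_iff_map,
          Submodule.ker_mkQ], by
        rw [← LinearMap.range_eq_top, Submodule.range_mapQ, LinearMap.range_eq_top.2 hp,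
          Submodule.map_top, Submodule.range_mkQ]⟩
  rw [codim_eq_map, codim_eq_map]
  have h : (A.map p).map D.mkQ = (A.map (D.comap p).mkQ).map e.toLinearMap := by
    rw [← Submodule.map_comp, ← Submodule.map_comp]
    rfl
  rw [h]
  have := congrArg Cardinal.toENat (LinearEquiv.lift_rank_map_eq e (A.map (D.comap p).mkQ))
  simpa using this.symm

lemma trajectory_succ (φ : V →ₗ[K] V) (n : ℕ) (U : Submodule K V) :
    trajectory φ (n + 1) U = U ⊔ (trajectory φ n U).map φ := by
  apply le_antisymm
  · rw [trajectory_le_iff]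
    rintro (_ | i) hi
    · simp [Module.End.one_eq_id]
    · refine le_trans ?_ le_sup_right
      rw [pow_succ', Module.End.mul_eq_comp, Submodule.map_comp]
      exact Submodule.map_mono (map_pow_le_trajectory φ (by omega) U)
  · refine sup_le ?_ ?_
    · simpa [Module.End.one_eq_id] using map_pow_le_trajectory φ (Nat.succ_pos n) U
    · rw [Submodule.map_le_iff_le_comap, trajectory_le_iff]
      intro i hi
      rw [← Submodule.map_le_iff_le_comap, ← Submodule.map_comp, ← Module.End.mul_eq_comp,
        ← pow_succ']
      exact map_pow_le_trajectory φ (by omega) U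

lemma trajectory_zero (φ : V →ₗ[K] V) (U : Submodule K V) : trajectory φ 0 U = ⊥ := by
  simp [trajectory]

lemma le_trajectory_succ (φ : V →ₗ[K] V) (n : ℕ) (U : Submodule K V) :
    U ≤ trajectory φ (n + 1) U :=
  trajectory_succ φ n U ▸ le_sup_left

lemma trajectory_mono (φ : V →ₗ[K] V) (U : Submodule K V) :
    Monotone fun n => trajectory φ n U := by
  intro m n h
  exact (trajectory_le_iff φ m U _).2
    fun i hi => map_pow_le_trajectory φ (hi.trans_le h) U

lemma map_trajectory_le (φ : V →ₗ[K] V) (n : ℕ) (U : Submodule K V) :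
    (trajectory φ n U).map φ ≤ trajectory φ (n + 1) U :=
  trajectory_succ φ n U ▸ le_sup_right

/-- If `p` has a section `i` and `D` contains `p φ (ker p)`, then the entropy of `φ` at `p⁻¹ D` is
that of the compression `p φ i` at `D`. -/
lemma entAt_comap {C : Type*} [AddCommGroup C] [Module K C] (φ : V →ₗ[K] V) {p : V →ₗ[K] C}
    {i : C →ₗ[K] V} (hpi : p ∘ₗ i = LinearMap.id) {D : Submodule K C}
    (hD : (LinearMap.ker p).map (p ∘ₗ φ) ≤ D) :
    entAt φ (D.comap p) = entAt (p ∘ₗ φ ∘ₗ i) D := by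
  have hpi' : ∀ c, p (i c) = c := fun c => LinearMap.congr_fun hpi c
  have hp : Function.Surjective p := fun c => ⟨i c, hpi' c⟩
  have hmap : ∀ x, p (φ x) - p (φ (i (p x))) ∈ D := fun x => by
    refine hD ⟨x - i (p x), ?_, by simp⟩
    simp [hpi']
  -- The discrepancy `hmap` is absorbed by the summand `D` of the next trajectory.
  have htraj : ∀ n, (trajectory φ n (D.comap p)).map p = trajectory (p ∘ₗ φ ∘ₗ i) n D := by
    intro n
    induction n with
    | zero => simp [trajectory_zero]
    | succ n ih =>
      rw [trajectory_succ, trajectory_succ, ← ih, Submodule.map_sup,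
        Submodule.map_comap_eq_of_surjective hp]
      apply le_antisymm
      · refine sup_le le_sup_left ?_
        rintro _ ⟨_, ⟨x, hx, rfl⟩, rfl⟩
        rw [← sub_add_cancel (p (φ x)) (p (φ (i (p x))))]
        exact Submodule.add_mem_sup (hmap x) ⟨p x, ⟨x, hx, rfl⟩, rfl⟩
      · refine sup_le le_sup_left ?_
        rintro _ ⟨_, ⟨x, hx, rfl⟩, rfl⟩
        have : p (φ (i (p x))) = -(p (φ x) - p (φ (i (p x)))) + p (φ x) := by abel
        rw [LinearMap.comp_apply, LinearMap.comp_apply, this]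
        exact Submodule.add_mem_sup (D.neg_mem (hmap x)) ⟨φ x, ⟨x, hx, rfl⟩, rfl⟩
  rw [entAt, entAt]
  simp_rw [codim_eq_codim_map hp, htraj]

end Algebra

/-! ### Discrete case: entropy as rank over `K[X]` -/

section Discrete

variable {K : Type*} [Field K] {C : Type*} [AddCommGroup C] [Module K C] (ψ : C →ₗ[K] C)
  (D : Submodule K C)

open Polynomial

instance finiteDimensional_trajectory [FiniteDimensional K D] (n : ℕ) :
    FiniteDimensional K (trajectory ψ n D) := by
  induction n with
  | zero => rw [trajectory_zero]; infer_instance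
  | succ n ih => rw [trajectory_succ]; infer_instance

/-- The `n r` vectors `ψ^k v_j` with `k < n` lie in `T_n` and are independent over `K`. -/
lemma le_entAt_of_linearIndependent [FiniteDimensional K D] {r : ℕ}
    {v : Fin r → Module.AEval' ψ} (hv : LinearIndependent K[X] v)
    (hD : ∀ j, (Module.AEval'.of ψ).symm (v j) ∈ D) : (r : ℝ≥0∞) ≤ entAt ψ D := by
  have key : ∀ n : ℕ, n * r ≤ Module.finrank K (trajectory ψ n D) := by
    intro n
    have hX : LinearIndependent K (fun k : Fin n => (X ^ (k : ℕ) : K[X])) := by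
      have := (Polynomial.basisMonomials K).linearIndependent.comp (fun k : Fin n => (k : ℕ))
        Fin.val_injective
      simpa [Function.comp_def, Polynomial.X_pow_eq_monomial] using this
    have h1 := linearIndependent_smul hX hv
    have h2 := h1.map' ((Module.AEval'.of ψ).symm.toLinearMap) (LinearEquiv.ker _)
    have hmem : ∀ q : Fin n × Fin r, (Module.AEval'.of ψ).symm ((X ^ (q.1 : ℕ) : K[X]) • v q.2) ∈
        trajectory ψ n D := by
      intro q
      refine map_pow_le_trajectory ψ q.1.2 D ⟨_, hD q.2, ?_⟩
      rw [Module.AEval.of_symm_smul, aeval_X_pow]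
      rfl
    have h3 : LinearIndependent K
        (fun q : Fin n × Fin r => (⟨_, hmem q⟩ : trajectory ψ n D)) :=
      LinearIndependent.of_comp (trajectory ψ n D).subtype h2
    simpa using h3.fintype_card_le_finrank
  refine le_of_tendsto_div_nat (a := fun n => n * r) (c := (Module.finrank K D : ℝ≥0∞)) (by simp)
    (.of_forall fun n => ?_) (tendsto_const_nhds.congr' ?_) (tendsto_entAt ψ D)
  · have h1 := rank_le_rank_map_add_rank_ker D.mkQ (trajectory ψ n D)
    rw [← codim_eq_map, Submodule.ker_mkQ, ← Module.finrank_eq_rank, ← Module.finrank_eq_rank,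
      map_natCast, map_natCast] at h1
    have h2 : ((n * r : ℕ) : ℕ∞) ≤ codim (trajectory ψ n D) D + (Module.finrank K D : ℕ∞) :=
      le_trans (by exact_mod_cast key n) h1
    have h3 := ENat.toENNReal_le.2 h2
    simpa using h3
  · filter_upwards [eventually_gt_atTop 0] with n hn
    rw [mul_comm, ENNReal.mul_div_cancel_right (by simpa using hn.ne') (by simp)]

/-- The elements of `T_{n+1}` that `ψ` maps to `T_{n+1}` form a space of dimension
`2 dim T_{n+1} - dim T_{n+2}`. -/
lemma finrank_trajectory_add [FiniteDimensional K D] (n : ℕ) :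
    Module.finrank K (trajectory ψ (n + 1 + 1) D) + Module.finrank K
        (trajectory ψ (n + 1) D ⊓ (trajectory ψ (n + 1) D).comap ψ : Submodule K C) =
      Module.finrank K (trajectory ψ (n + 1) D) + Module.finrank K (trajectory ψ (n + 1) D) := by
  set T := trajectory ψ (n + 1) D
  -- This needs `D ≤ T`, which can fail for `T_0 = 0`; hence the index `n + 1`.
  have hT : trajectory ψ (n + 1 + 1) D = T ⊔ T.map ψ := by
    refine le_antisymm ?_ (sup_le (trajectory_mono ψ D (Nat.le_succ _)) (map_trajectory_le ψ _ D))
    rw [trajectory_succ]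
    exact sup_le_sup_right (le_trajectory_succ ψ n D) _
  have h1 := Submodule.finrank_sup_add_finrank_inf_eq T (T.map ψ)
  have h2 := (ψ.domRestrict T).finrank_range_add_finrank_ker
  have h3 := (ψ.domRestrict (T ⊓ T.comap ψ)).finrank_range_add_finrank_ker
  have h4 : LinearMap.range (ψ.domRestrict (T ⊓ T.comap ψ)) = T ⊓ T.map ψ := by
    rw [LinearMap.range_domRestrict]
    ext x
    constructor
    · rintro ⟨y, hy, rfl⟩
      exact ⟨hy.2, y, hy.1, rfl⟩
    · rintro ⟨hx, y, hy, rfl⟩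
      exact ⟨y, ⟨hy, hx⟩, rfl⟩
  have h5 : Module.finrank K (LinearMap.ker (ψ.domRestrict T)) =
      Module.finrank K (LinearMap.ker (ψ.domRestrict (T ⊓ T.comap ψ))) := by
    refine LinearEquiv.finrank_eq
      { toFun := fun x => ⟨⟨x.1.1, x.1.2, by
          have : ψ x.1.1 = 0 := x.2
          simp [this]⟩, x.2⟩
        invFun := fun x => ⟨⟨x.1.1, x.1.2.1⟩, x.2⟩
        map_add' := fun _ _ => rfl
        map_smul' := fun _ _ => rfl
        left_inv := fun _ => rfl
        right_inv := fun _ => rfl }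
  rw [h4] at h3
  rw [LinearMap.range_domRestrict] at h2
  rw [hT]
  omega

lemma trajectory_le_inf_comap (n : ℕ) :
    trajectory ψ n D ≤ trajectory ψ (n + 1) D ⊓ (trajectory ψ (n + 1) D).comap ψ :=
  le_inf (trajectory_mono ψ D (Nat.le_succ _))
    (Submodule.map_le_iff_le_comap.1 (map_trajectory_le ψ n D))

/-- The dimensions are concave in `n`, so their increments form a non-increasing sequence of
naturals, eventually constant. -/
lemma exists_finrank_trajectory_eq [FiniteDimensional K D] :
    ∃ N α : ℕ, ∀ n ≥ N, Module.finrank K (trajectory ψ (n + 1) D) =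
      Module.finrank K (trajectory ψ n D) + α := by
  set d := fun n => Module.finrank K (trajectory ψ n D)
  have hd : Monotone d := fun m n h => Submodule.finrank_mono (trajectory_mono ψ D h)
  have hanti : Antitone fun n => d (n + 1) - d n := by
    refine antitone_nat_of_succ_le fun n => ?_
    have h1 := finrank_trajectory_add ψ D n
    have h2 := Submodule.finrank_mono (trajectory_le_inf_comap ψ D n)
    simp only [d]
    omega
  obtain ⟨N, hN⟩ := WellFoundedLT.antitone_chain_condition hanti
  refine ⟨N, d (N + 1) - d N, fun n hn => ?_⟩
  have h1 := hN n hn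
  have h2 := hd (Nat.le_succ n)
  change d (n + 1) = d n + (d (N + 1) - d N)
  rw [h1, Nat.add_sub_cancel' h2]

/-- The entropy at a finite-dimensional subspace is bounded by the number of elements of some
`K[X]`-linearly independent family. -/
lemma entAt_le_of_finiteDimensional [FiniteDimensional K D] :
    ∃ (r : ℕ) (v : Fin r → Module.AEval' ψ), LinearIndependent K[X] v ∧ entAt ψ D ≤ r := by
  obtain ⟨N, α, hα⟩ := exists_finrank_trajectory_eq ψ D
  -- Constant increments give equality of dimensions in `trajectory_le_inf_comap`, so `ψ` is
  -- injective from `T_{n+1}/T_n` to `T_{n+2}/T_{n+1}`.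
  have hstep : ∀ n ≥ N, ∀ x ∈ trajectory ψ (n + 1) D, ψ x ∈ trajectory ψ (n + 1) D →
      x ∈ trajectory ψ n D := by
    intro n hn x hx hψx
    have : trajectory ψ n D = trajectory ψ (n + 1) D ⊓ (trajectory ψ (n + 1) D).comap ψ := by
      refine Submodule.eq_of_le_of_finrank_eq (trajectory_le_inf_comap ψ D n) ?_
      have h1 := finrank_trajectory_add ψ D n
      have h2 := hα n hn
      have h3 := hα (n + 1) (by omega)
      omega
    rw [this]
    exact ⟨hx, hψx⟩
  have hpow_mem : ∀ m n x, x ∈ trajectory ψ n D → (ψ ^ m) x ∈ trajectory ψ (n + m) D := by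
    intro m n x hx
    induction m with
    | zero => simpa using hx
    | succ m ih =>
      rw [pow_succ', Module.End.mul_apply]
      exact map_trajectory_le ψ _ D ⟨_, ih, rfl⟩
  have hpow : ∀ m, ∀ x ∈ trajectory ψ (N + 1) D, (ψ ^ m) x ∈ trajectory ψ (N + m) D →
      x ∈ trajectory ψ N D := by
    intro m x hx hm
    induction m with
    | zero => simpa using hm
    | succ m ih =>
      refine ih (hstep (N + m) (by omega) _ ?_ ?_)
      · have := hpow_mem m _ x hx
        rwa [add_right_comm] at this
      · rwa [pow_succ', Module.End.mul_apply] at hm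
  set T := trajectory ψ N D with hTdef
  set T' := trajectory ψ (N + 1) D with hT'def
  have hTT' : T ≤ T' := trajectory_mono ψ D (Nat.le_succ N)
  have hq : Module.finrank K (T' ⧸ T.submoduleOf T') = α := by
    have h1 := (T.submoduleOf T').finrank_quotient_add_finrank
    have h2 : Module.finrank K T' = Module.finrank K T + α := hα N le_rfl
    rw [(Submodule.submoduleOfEquivOfLe hTT').finrank_eq] at h1
    omega
  -- Lifts of a basis of `T_{N+1}/T_N` will be the `K[X]`-independent family.
  let b := Module.finBasisOfFinrankEq K (T' ⧸ T.submoduleOf T') hq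
  choose e he using fun j => (T.submoduleOf T').mkQ_surjective (b j)
  have he_ind : ∀ c : Fin α → K, ∑ j, c j • (e j : C) ∈ T → ∀ j, c j = 0 := by
    intro c hc
    refine Fintype.linearIndependent_iff.1 b.linearIndependent c ?_
    simp_rw [← he, ← map_smul, ← map_sum]
    rw [Submodule.mkQ_apply, Submodule.Quotient.mk_eq_zero]
    simpa [Submodule.submoduleOf] using hc
  refine ⟨α, fun j => Module.AEval'.of ψ (e j), ?_, ?_⟩
  · rw [Fintype.linearIndependent_iff]
    intro P hP
    have hP' : ∑ j, aeval ψ (P j) (e j : C) = 0 := by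
      have := congrArg (Module.AEval'.of ψ).symm hP
      simpa [Module.AEval.of_symm_smul] using this
    -- In a relation of degree at most `m`, the terms below degree `m` lie in `T_{N+m}`. So `ψ^m`
    -- sends the combination of the `e j` with the degree-`m` coefficients into `T_{N+m}`; by `hpow`
    -- it lies in `T_N`, and these coefficients vanish.
    have hdeg : ∀ m : ℕ, (∀ j, (P j).degree < m) → ∀ j, P j = 0 := by
      intro m
      induction m with
      | zero =>
        intro h j
        ext k
        exact (Polynomial.degree_lt_iff_coeff_zero _ _).1 (h j) k (Nat.zero_le k)
      | succ m ih =>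
        intro h
        have hcoeff : ∀ j, (P j).coeff m = 0 := by
          refine he_ind _ (hpow m _ (sum_mem fun j _ => T'.smul_mem _ (e j).2) ?_)
          have hexp : ∀ j, aeval ψ (P j) (e j : C) = (P j).coeff m • (ψ ^ m) (e j : C) +
              ∑ k ∈ Finset.range m, (P j).coeff k • (ψ ^ k) (e j : C) := by
            intro j
            have hlt : (P j).natDegree < m + 1 := by
              by_cases h0 : P j = 0
              · simp [h0]
              · exact (Polynomial.natDegree_lt_iff_degree_lt h0).2 (h j)
            rw [aeval_eq_sum_range' hlt, Finset.sum_range_succ, add_comm]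
            simp
          simp_rw [hexp, Finset.sum_add_distrib] at hP'
          rw [map_sum]
          simp_rw [map_smul]
          rw [eq_neg_of_add_eq_zero_left hP']
          refine neg_mem (sum_mem fun j _ => sum_mem fun k hk => Submodule.smul_mem _ _ ?_)
          refine trajectory_mono ψ D ?_ (hpow_mem k (N + 1) _ (e j).2)
          have := Finset.mem_range.1 hk
          omega
        refine ih fun j => ?_
        rw [Polynomial.degree_lt_iff_coeff_zero]
        intro k hk
        rcases hk.eq_or_lt with rfl | hk
        · exact hcoeff j
        · exact (Polynomial.degree_lt_iff_coeff_zero _ _).1 (h j) k hk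
    obtain ⟨m, hm⟩ : ∃ m : ℕ, ∀ j, (P j).degree < m := by
      refine ⟨(∑ j, (P j).natDegree) + 1, fun j => ?_⟩
      refine lt_of_le_of_lt (Polynomial.degree_le_natDegree) ?_
      have := Finset.single_le_sum (f := fun j => (P j).natDegree) (fun _ _ => Nat.zero_le _)
        (Finset.mem_univ j)
      exact_mod_cast Nat.lt_succ_of_le this
    exact hdeg m hm
  · have hfin : ∀ k, Module.finrank K (trajectory ψ (N + k) D) = Module.finrank K T + k * α := by
      intro k
      induction k with
      | zero => simp [T]
      | succ k ih => rw [← add_assoc, hα (N + k) (by omega), ih]; ring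
    refine le_of_tendsto_div_nat (b := fun n => n * α) (c := (Module.finrank K T : ℝ≥0∞)) (by simp)
      ?_ (tendsto_entAt ψ D) (tendsto_const_nhds.congr' ?_)
    · filter_upwards [eventually_ge_atTop N] with n hn
      have h1 : codim (trajectory ψ n D) D ≤ (Module.finrank K (trajectory ψ n D) : ℕ∞) := by
        rw [← map_natCast Cardinal.toENat, Module.finrank_eq_rank, codim]
        exact OrderHomClass.mono _ (rank_quotient_le _)
      obtain ⟨k, rfl⟩ := Nat.exists_eq_add_of_le hn
      rw [hfin] at h1
      have h2 : codim (trajectory ψ (N + k) D) D ≤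
          (((N + k) * α + Module.finrank K T : ℕ) : ℕ∞) := by
        refine h1.trans ?_
        norm_cast
        nlinarith [Nat.zero_le (N * α)]
      have h3 := ENat.toENNReal_le.2 h2
      simpa using h3
    · filter_upwards [eventually_gt_atTop 0] with n hn
      rw [mul_comm, ENNReal.mul_div_cancel_right (by simpa using hn.ne') (by simp)]

/-- The supremum of the entropies at the finite-dimensional subspaces containing a given one is
the rank over `K[X]`. -/
lemma iSup_entAt_eq_rank [FiniteDimensional K D] :
    ⨆ (E : Submodule K C) (_ : FiniteDimensional K E) (_ : D ≤ E), entAt ψ E =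
      (Cardinal.toENat (Module.rank K[X] (Module.AEval' ψ)) : ℝ≥0∞) := by
  apply le_antisymm
  · refine iSup_le fun E => iSup_le fun hE => iSup_le fun _ => ?_
    obtain ⟨r, v, hv, hr⟩ := entAt_le_of_finiteDimensional ψ E
    have h1 : (r : ℕ∞) ≤ Cardinal.toENat (Module.rank K[X] (Module.AEval' ψ)) := by
      rw [← map_natCast Cardinal.toENat]
      exact OrderHomClass.mono _ (Module.le_rank_iff.2 ⟨v, hv⟩)
    refine hr.trans ?_
    simpa using ENat.toENNReal_le.2 h1
  · have h1 : ∀ r : ℕ, (r : ℕ∞) ≤ Cardinal.toENat (Module.rank K[X] (Module.AEval' ψ)) →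
        (r : ℝ≥0∞) ≤
          ⨆ (E : Submodule K C) (_ : FiniteDimensional K E) (_ : D ≤ E), entAt ψ E := by
      intro r hr
      obtain ⟨v, hv⟩ := Module.le_rank_iff.1 (Cardinal.natCast_le_toENat.1 hr)
      let E := D ⊔ Submodule.span K (Set.range fun j => (Module.AEval'.of ψ).symm (v j))
      have hE : FiniteDimensional K E := by
        have := FiniteDimensional.span_of_finite K
          (Set.finite_range fun j => (Module.AEval'.of ψ).symm (v j))
        infer_instance
      refine le_trans (le_entAt_of_linearIndependent ψ E hv fun j =>
        Submodule.mem_sup_right (Submodule.subset_span ⟨j, rfl⟩)) ?_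
      exact le_iSup_of_le E (le_iSup_of_le hE (le_iSup_of_le le_sup_left le_rfl))
    -- An infinite rank is reached through all finite `r` below it.
    generalize Cardinal.toENat (Module.rank K[X] (Module.AEval' ψ)) = ρ at h1 ⊢
    induction ρ using ENat.recTopCoe with
    | top =>
      rw [ENat.toENNReal_top, top_le_iff]
      exact ENNReal.eq_top_of_forall_nnreal_le fun q =>
        le_trans (by exact_mod_cast Nat.le_ceil q) (h1 ⌈q⌉₊ le_top)
    | coe n => simpa using h1 n le_rfl

end Discrete

/-! ### Linearly compact spaces and the rank formula -/

section Topology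

variable {K : Type*} [Field K]
  {X : Type*} [AddCommGroup X] [Module K X] [TopologicalSpace X]
  {Y : Type*} [AddCommGroup Y] [Module K Y] [TopologicalSpace Y]

lemma isLinearTopology_of_isInducing [IsLinearTopology K Y] {f : X →ₗ[K] Y}
    (hf : IsInducing f) : IsLinearTopology K X := by
  refine .mk_of_hasBasis K (s := fun N : Submodule K Y => N.comap f)
    (p := fun N : Submodule K Y => (N : Set Y) ∈ 𝓝 0) ?_
  rw [hf.nhds_eq_comap, map_zero]
  exact (IsLinearTopology.hasBasis_submodule K).comap f

instance isLinearTopology_submodule [IsLinearTopology K X] (W : Submodule K X) :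
    IsLinearTopology K W :=
  isLinearTopology_of_isInducing (f := W.subtype) IsInducing.subtypeVal

instance continuousConstSMul_submodule [ContinuousConstSMul K X] (W : Submodule K X) :
    ContinuousConstSMul K W :=
  ⟨fun c => (continuous_subtype_val.const_smul c).subtype_mk _⟩

instance isLinearTopology_quotient [IsTopologicalAddGroup X] [IsLinearTopology K X]
    (W : Submodule K X) : IsLinearTopology K (X ⧸ W) := by
  refine .mk_of_hasBasis K (s := fun N : Submodule K X => N.map W.mkQ)
    (p := fun N : Submodule K X => (N : Set X) ∈ 𝓝 0) ?_
  have : 𝓝 (0 : X ⧸ W) = map W.mkQ (𝓝 0) := by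
    rw [← map_zero W.mkQ]
    exact (W.isOpenQuotientMap_mkQ.map_nhds_eq 0).symm
  rw [this]
  exact (IsLinearTopology.hasBasis_submodule K).map W.mkQ

/-- The point `y₀` excludes the empty preimage, which is not a variety. -/
lemma IsClosedLinearVariety.preimage {s : Set X} (hs : IsClosedLinearVariety K s) {f : Y →ₗ[K] X}
    (hf : Continuous f) (x₀ : X) {y₀ : Y} (hy₀ : f y₀ + x₀ ∈ s) :
    IsClosedLinearVariety K {y | f y + x₀ ∈ s} := by
  obtain ⟨v, W, hW, rfl⟩ := hs
  refine ⟨y₀, W.comap f, hW.preimage hf, ?_⟩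
  rw [Set.mem_vadd_set_iff_neg_vadd_mem, SetLike.mem_coe] at hy₀
  ext y
  simp only [Set.mem_ofPred_eq, Set.mem_vadd_set_iff_neg_vadd_mem, SetLike.mem_coe,
    Submodule.mem_comap, vadd_eq_add] at hy₀ ⊢
  rw [← Submodule.sub_mem_iff_left (p := W) (x := -v + (f y + x₀)) hy₀]
  rw [map_add, map_neg, show -v + (f y + x₀) - (-v + (f y₀ + x₀)) = -f y₀ + f y by abel]

lemma IsClosedLinearVariety.lineMap_mem {s : Set X} (hs : IsClosedLinearVariety K s) {y z : X}
    (hy : y ∈ s) (hz : z ∈ s) (t : K) : y + t • (z - y) ∈ s := by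
  obtain ⟨v, W, -, rfl⟩ := hs
  simp only [Set.mem_vadd_set_iff_neg_vadd_mem, SetLike.mem_coe, vadd_eq_add] at hy hz ⊢
  rw [← add_assoc]
  refine W.add_mem hy (W.smul_mem t ?_)
  simpa using W.sub_mem hz hy

lemma IsLinearlyCompact.iInter_nonempty (hX : IsLinearlyCompact K X) {ι : Type*} {s : ι → Set X}
    (hs : ∀ i, IsClosedLinearVariety K (s i)) (hfin : ∀ t : Finset ι, (⋂ i ∈ t, s i).Nonempty) :
    (⋂ i, s i).Nonempty := by
  classical
  rw [← Set.sInter_range]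
  refine hX.fip _ (by rintro _ ⟨i, rfl⟩; exact hs i) fun F hF hFfin => ?_
  have := hFfin.fintype
  choose g hg using fun a : F => hF a.2
  refine (hfin (Finset.univ.image g)).mono fun x hx => ?_
  rw [Set.mem_sInter]
  intro a ha
  rw [← show s (g ⟨a, ha⟩) = a from hg ⟨a, ha⟩]
  exact Set.mem_iInter₂.1 hx _ (Finset.mem_image_of_mem _ (Finset.mem_univ _))

lemma IsLinearlyCompact.of_surjective [T2Space Y] [IsTopologicalAddGroup Y]
    [ContinuousConstSMul K Y] [IsLinearTopology K Y] (hX : IsLinearlyCompact K X)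
    {f : X →ₗ[K] Y} (hf : Continuous f) (hsurj : Function.Surjective f) :
    IsLinearlyCompact K Y := by
  refine ⟨inferInstance, inferInstance, inferInstance, inferInstance, fun S hS hF => ?_⟩
  have hne : ∀ s ∈ S, ∃ x, f x ∈ s := by
    intro s hs
    obtain ⟨y, hy⟩ := hF {s} (by simpa using hs) (Set.finite_singleton s)
    obtain ⟨x, rfl⟩ := hsurj y
    exact ⟨x, by simpa using hy⟩
  obtain ⟨x, hx⟩ := hX.iInter_nonempty (s := fun s : S => {x | f x + 0 ∈ s.1})
    (fun s => by
      obtain ⟨x, hx⟩ := hne s s.2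
      exact (hS s s.2).preimage hf 0 (y₀ := x) (by simpa using hx))
    (fun t => by
      obtain ⟨y, hy⟩ := hF (Subtype.val '' (t : Set S)) (by rintro _ ⟨s, -, rfl⟩; exact s.2)
        (t.finite_toSet.image _)
      obtain ⟨x, rfl⟩ := hsurj y
      refine ⟨x, Set.mem_iInter₂.2 fun s hs => ?_⟩
      simpa using hy s.1 ⟨s, hs, rfl⟩)
  refine ⟨f x, fun s hs => ?_⟩
  simpa using Set.mem_iInter.1 hx ⟨s, hs⟩

lemma IsLinearlyCompact.of_isClosedEmbedding [IsTopologicalAddGroup Y] [ContinuousConstSMul K Y]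
    (hX : IsLinearlyCompact K X) {f : Y →ₗ[K] X} (hf : IsClosedEmbedding f) :
    IsLinearlyCompact K Y := by
  have := hX.t2
  have := hX.linear
  refine ⟨hf.isEmbedding.t2Space, inferInstance, inferInstance,
    isLinearTopology_of_isInducing hf.isInducing, fun S hS hF => ?_⟩
  -- A member of `S` is needed to place the common point in the range of `f`.
  rcases S.eq_empty_or_nonempty with rfl | ⟨s₀, hs₀⟩
  · simp
  obtain ⟨x, hx⟩ := hX.iInter_nonempty (s := fun s : S => f '' s.1)
    (fun s => by
      obtain ⟨v, W, hW, hs⟩ := hS s s.2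
      refine ⟨f v, W.map f, hf.isClosedMap _ hW, ?_⟩
      ext x
      simp only [hs, Set.mem_image, Set.mem_vadd_set, SetLike.mem_coe, Submodule.mem_map,
        vadd_eq_add, exists_exists_and_eq_and, map_add])
    (fun t => by
      obtain ⟨y, hy⟩ := hF (Subtype.val '' (t : Set S)) (by rintro _ ⟨s, -, rfl⟩; exact s.2)
        (t.finite_toSet.image _)
      exact ⟨f y, Set.mem_iInter₂.2 fun s hs => ⟨y, hy s.1 ⟨s, hs, rfl⟩, rfl⟩⟩)
  rw [Set.mem_iInter] at hx
  obtain ⟨y, -, rfl⟩ := hx ⟨s₀, hs₀⟩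
  exact ⟨y, fun s hs => (hf.injective.mem_set_image).1 (hx ⟨s, hs⟩)⟩

/-- An open subspace of a linearly compact space has finite codimension. -/
lemma IsLinearlyCompact.finiteDimensional_quotient (hX : IsLinearlyCompact K X)
    {O : Submodule K X} (hO : IsOpen (O : Set X)) : FiniteDimensional K (X ⧸ O) := by
  have := hX.addGroup
  let b := Module.Basis.ofVectorSpace K (X ⧸ O)
  -- The varieties "coordinate `i` equals `1`" have the finite intersection property; a common point
  -- has finite support, so the basis is finite.
  have hfin : ∀ t : Finset (Module.Basis.ofVectorSpaceIndex K (X ⧸ O)),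
      ∃ x, ∀ i ∈ t, b.repr (O.mkQ x) i = 1 := by
    classical
    intro t
    obtain ⟨x, hx⟩ := O.mkQ_surjective (∑ i ∈ t, b i)
    refine ⟨x, fun i hi => ?_⟩
    rw [hx, map_sum, Finsupp.finsetSum_apply]
    simp [Finsupp.single_apply, hi]
  obtain ⟨x, hx⟩ := hX.iInter_nonempty (s := fun i => {x | b.repr (O.mkQ x) i = 1})
    (fun i => by
      obtain ⟨v, hv⟩ := hfin {i}
      have hv : b.repr (O.mkQ v) i = 1 := hv i (by simp)
      let W : Submodule K X := LinearMap.ker (b.coord i ∘ₗ O.mkQ)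
      have hOW : O ≤ W := fun x hx => by
        have : O.mkQ x = 0 := by simpa using hx
        simp [W, LinearMap.mem_ker, this]
      have hW : IsOpen (W : Set X) :=
        AddSubgroup.isOpen_mono (H₁ := O.toAddSubgroup) (H₂ := W.toAddSubgroup) hOW hO
      refine ⟨v, W, AddSubgroup.isClosed_of_isOpen W.toAddSubgroup hW, ?_⟩
      ext x
      rw [Set.mem_vadd_set_iff_neg_vadd_mem, SetLike.mem_coe, LinearMap.mem_ker,
        Set.mem_ofPred_eq, vadd_eq_add, map_add, map_neg, LinearMap.comp_apply,
        LinearMap.comp_apply, Module.Basis.coord_apply, Module.Basis.coord_apply, hv,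
        neg_add_eq_zero, eq_comm])
    (fun t => by
      obtain ⟨x, hx⟩ := hfin t
      exact ⟨x, Set.mem_iInter₂.2 hx⟩)
  rw [Set.mem_iInter] at hx
  have hfinite : Finite (Module.Basis.ofVectorSpaceIndex K (X ⧸ O)) := by
    refine Set.finite_univ_iff.1 ((b.repr (O.mkQ x)).hasFiniteSupport.subset fun i _ => ?_)
    have : b.repr (O.mkQ x) i = 1 := hx i
    rw [Function.mem_support, this]
    exact one_ne_zero
  exact Module.Finite.of_basis b

lemma IsLinearlyCompact.of_sup_span_singleton [T2Space X] [IsTopologicalAddGroup X]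
    [ContinuousConstSMul K X] [IsLinearTopology K X] {U : Submodule K X}
    (hU : IsLinearlyCompact K U) {x : X} (hx : U ⊔ K ∙ x = ⊤) : IsLinearlyCompact K X := by
  refine ⟨inferInstance, inferInstance, inferInstance, inferInstance, fun S hS hF => ?_⟩
  have hspan : ∀ y : X, ∃ a : K, U.mkQ y = a • U.mkQ x := by
    intro y
    obtain ⟨u, hu, z, hz, rfl⟩ := Submodule.mem_sup.1 (hx ▸ Submodule.mem_top : y ∈ U ⊔ K ∙ x)
    obtain ⟨a, rfl⟩ := Submodule.mem_span_singleton.1 hz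
    refine ⟨a, ?_⟩
    have : U.mkQ u = 0 := by simpa using hu
    rw [map_add, map_smul, this, zero_add]
  -- One coset of `U` meets every finite intersection. Either some finite intersection lies in a
  -- single coset, or each contains points `y`, `z` of two cosets; the line through them then meets
  -- `U`, at parameter `a / (a - b)`, since `X/U` is spanned by one vector.
  obtain ⟨x₀, hx₀⟩ : ∃ x₀ : X, ∀ F ⊆ S, F.Finite → ∃ y ∈ ⋂₀ F, U.mkQ y = U.mkQ x₀ := by
    by_cases h : ∃ F₀ ⊆ S, F₀.Finite ∧ ∃ x₀, ∀ y ∈ ⋂₀ F₀, U.mkQ y = U.mkQ x₀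
    · obtain ⟨F₀, hF₀, hfin₀, x₀, hx₀⟩ := h
      refine ⟨x₀, fun F hFS hfin => ?_⟩
      obtain ⟨y, hy⟩ := hF (F ∪ F₀) (Set.union_subset hFS hF₀) (hfin.union hfin₀)
      rw [Set.sInter_union] at hy
      exact ⟨y, hy.1, hx₀ y hy.2⟩
    · push Not at h
      refine ⟨0, fun F hFS hfin => ?_⟩
      obtain ⟨y, hy⟩ := hF F hFS hfin
      obtain ⟨z, hz, hzy⟩ := h F hFS hfin y
      obtain ⟨a, ha⟩ := hspan y
      obtain ⟨b, hb⟩ := hspan z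
      have hab : a - b ≠ 0 := fun hab => hzy (by rw [ha, hb, sub_eq_zero.1 hab])
      refine ⟨y + (a / (a - b)) • (z - y),
        fun s hs => (hS s (hFS hs)).lineMap_mem (hy s hs) (hz s hs) _, ?_⟩
      rw [map_add, map_smul, map_sub, ha, hb, map_zero, ← sub_smul, smul_smul, ← add_smul]
      have : a + a / (a - b) * (b - a) = 0 := by field_simp; ring
      rw [this, zero_smul]
  have hmem : ∀ F ⊆ S, F.Finite → ∃ u : U, ∀ s ∈ F, U.subtype u + x₀ ∈ s := by
    intro F hFS hfin
    obtain ⟨y, hy, hyx⟩ := hx₀ F hFS hfin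
    refine ⟨⟨y - x₀, (Submodule.Quotient.eq U).1 hyx⟩, fun s hs => ?_⟩
    simpa using hy s hs
  obtain ⟨u, hu⟩ := hU.iInter_nonempty (s := fun s : S => {u : U | U.subtype u + x₀ ∈ s.1})
    (fun s => by
      obtain ⟨u, hu⟩ := hmem {s.1} (by simp) (Set.finite_singleton _)
      exact (hS s s.2).preimage continuous_subtype_val x₀ (hu s.1 rfl))
    (fun t => by
      obtain ⟨u, hu⟩ := hmem (Subtype.val '' (t : Set S)) (by rintro _ ⟨s, -, rfl⟩; exact s.2)
        (t.finite_toSet.image _)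
      exact ⟨u, Set.mem_iInter₂.2 fun s hs => hu s.1 ⟨s, hs, rfl⟩⟩)
  exact ⟨u + x₀, fun s hs => Set.mem_iInter.1 hu ⟨s, hs⟩⟩

lemma IsLinearlyCompact.finiteDimensional_map {C : Type*} [AddCommGroup C] [Module K C]
    {U : Submodule K X} (hU : IsLinearlyCompact K U) {g : X →ₗ[K] C}
    (hg : IsOpen (LinearMap.ker g : Set X)) : FiniteDimensional K (U.map g) := by
  have hO : IsOpen (LinearMap.ker (g.domRestrict U) : Set U) :=
    hg.preimage continuous_subtype_val
  have := hU.finiteDimensional_quotient hO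
  rw [← LinearMap.range_domRestrict]
  exact (g.domRestrict U).quotKerEquivRange.finiteDimensional

variable [T2Space X] [IsTopologicalAddGroup X] [ContinuousConstSMul K X] [IsLinearTopology K X]

lemma sup_span_singleton_mem_openLC {U : Submodule K X} (hU : U ∈ openLC K X) (x : X) :
    U ⊔ K ∙ x ∈ openLC K X := by
  refine ⟨AddSubgroup.isOpen_mono (H₁ := U.toAddSubgroup) (H₂ := (U ⊔ K ∙ x).toAddSubgroup)
    (le_sup_left : U ≤ U ⊔ K ∙ x) hU.1, ?_⟩
  set T := U ⊔ K ∙ x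
  have hUT : U ≤ T := le_sup_left
  have hxT : x ∈ T := Submodule.mem_sup_right (Submodule.mem_span_singleton_self x)
  have h1 : IsLinearlyCompact K (U.submoduleOf T) := by
    refine hU.2.of_surjective (f := (Submodule.submoduleOfEquivOfLe hUT).symm.toLinearMap) ?_
      (LinearEquiv.surjective _)
    exact Continuous.subtype_mk (Continuous.subtype_mk continuous_subtype_val _) _
  refine h1.of_sup_span_singleton (x := ⟨x, hxT⟩) ?_
  rw [eq_top_iff]
  rintro ⟨y, hy⟩ -
  obtain ⟨u, hu, z, hz, rfl⟩ := Submodule.mem_sup.1 hy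
  obtain ⟨a, rfl⟩ := Submodule.mem_span_singleton.1 hz
  exact Submodule.mem_sup.2 ⟨⟨u, hUT hu⟩, hu, a • ⟨x, hxT⟩,
    Submodule.smul_mem _ _ (Submodule.mem_span_singleton_self _), rfl⟩

lemma sup_mem_openLC {U : Submodule K X} (hU : U ∈ openLC K X) (F : Submodule K X)
    [FiniteDimensional K F] : U ⊔ F ∈ openLC K X := by
  classical
  obtain ⟨s, rfl⟩ : F.FG := Module.Finite.iff_fg.1 inferInstance
  induction s using Finset.induction_on with
  | empty => simpa using hU
  | insert x s _ ih =>
    rw [Finset.coe_insert, Submodule.span_insert, sup_left_comm, sup_comm]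
    exact sup_span_singleton_mem_openLC ih x

open Polynomial in
/-- If `p : X → C` is a projection with linearly compact open kernel and section `i`, the entropy
of `φ` is the rank of `C` as a `K[X]`-module on which `X` acts as `p φ i`. -/
theorem ent_eq_rank {C : Type*} [AddCommGroup C] [Module K C] {φ : X →ₗ[K] X}
    (hφ : Continuous φ) {p : X →ₗ[K] C} {i : C →ₗ[K] X} (hpi : p ∘ₗ i = LinearMap.id)
    (hp : LinearMap.ker p ∈ openLC K X) :
    ent φ = (Cardinal.toENat (Module.rank K[X] (Module.AEval' (p ∘ₗ φ ∘ₗ i))) : ℝ≥0∞) := by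
  have hpi' : ∀ c, p (i c) = c := fun c => LinearMap.congr_fun hpi c
  set F := (LinearMap.ker p).map (p ∘ₗ φ)
  have hF : FiniteDimensional K F := hp.2.finiteDimensional_map (hp.1.preimage hφ)
  have hcomap : ∀ (E : Submodule K C) [FiniteDimensional K E], E.comap p ∈ openLC K X := by
    intro E _
    have : E.comap p = LinearMap.ker p ⊔ E.map i := by
      apply le_antisymm
      · intro x hx
        rw [← sub_add_cancel x (i (p x))]
        exact Submodule.add_mem_sup (by simp [hpi']) ⟨p x, hx, rfl⟩
      · refine sup_le (LinearMap.ker_le_comap p) ?_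
        rintro _ ⟨c, hc, rfl⟩
        simpa [hpi'] using hc
    rw [this]
    exact sup_mem_openLC hp _
  rw [← iSup_entAt_eq_rank _ F]
  apply le_antisymm
  · refine iSup₂_le fun U hU => ?_
    have hUfin : FiniteDimensional K (U.map p) := hU.2.finiteDimensional_map hp.1
    -- `U.map p` gives `U ≤ p⁻¹ E`; `F` makes `entAt_comap` applicable.
    let E := U.map p ⊔ F
    have hE : FiniteDimensional K E := Submodule.finiteDimensional_sup _ _
    refine le_trans ?_ (le_iSup_of_le E (le_iSup_of_le hE (le_iSup_of_le le_sup_right le_rfl)))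
    rw [← entAt_comap φ hpi le_sup_right]
    refine entAt_le_entAt φ (Submodule.map_le_iff_le_comap.1 le_sup_left) ?_
    have : FiniteDimensional K ((E.comap p).map U.mkQ) :=
      (hcomap E).2.finiteDimensional_map (by rw [Submodule.ker_mkQ]; exact hU.1)
    rw [codim_eq_map, ← Module.finrank_eq_rank, map_natCast]
    exact ENat.natCast_ne_top _
  · refine iSup_le fun E => iSup_le fun hE => iSup_le fun hFE => ?_
    rw [← entAt_comap φ hpi hFE]
    exact le_iSup₂_of_le _ (hcomap E) le_rfl

end Topology

open Polynomial in
-- Inclusion and quotient map are `K[X]`-linear, so rank-nullity over `K[X]` applies.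
lemma rank_aeval_restrict_add_rank_aeval_mapQ {K : Type*} [Field K] {C : Type*} [AddCommGroup C]
    [Module K C] (ψ : C →ₗ[K] C) (E : Submodule K C) (hE : ∀ x ∈ E, ψ x ∈ E) :
    Module.rank K[X] (Module.AEval' ψ) =
      Module.rank K[X] (Module.AEval' (E.mapQ E ψ hE)) +
        Module.rank K[X] (Module.AEval' (ψ.restrict hE)) := by
  let f : Module.AEval' ψ →ₗ[K[X]] Module.AEval' (E.mapQ E ψ hE) :=
    LinearMap.ofAEval ψ ((Module.AEval'.of (E.mapQ E ψ hE)).toLinearMap ∘ₗ E.mkQ) fun m =>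
      (Module.AEval'.X_smul_of (E.mapQ E ψ hE) (E.mkQ m)).symm
  let g : Module.AEval' (ψ.restrict hE) →ₗ[K[X]] Module.AEval' ψ :=
    LinearMap.ofAEval (ψ.restrict hE) ((Module.AEval'.of ψ).toLinearMap ∘ₗ E.subtype) fun m =>
      (Module.AEval'.X_smul_of ψ (E.subtype m)).symm
  have hf : Function.Surjective f := E.mkQ_surjective
  have hg : Function.Injective g := E.injective_subtype
  have hgf : LinearMap.range g = LinearMap.ker f := by
    ext x
    constructor
    · rintro ⟨y, rfl⟩
      exact (Submodule.Quotient.mk_eq_zero E).2 y.2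
    · intro hx
      exact ⟨(⟨x, (Submodule.Quotient.mk_eq_zero E).1 hx⟩ : E), rfl⟩
  rw [LinearMap.rank_eq_of_surjective hf, ← hgf, rank_range_of_injective g hg]

/-! ### Subspaces and quotients of locally linearly compact spaces -/

section LLC

variable {K : Type*} [Field K] {V : Type*} [AddCommGroup V] [Module K V] [TopologicalSpace V]

lemma IsLLC.isLinearTopology (hV : IsLLC K V) : IsLinearTopology K V :=
  .mk_of_hasBasis K hV

/-- The point `0` is closed in a Hausdorff open subspace, which is itself closed. -/
lemma IsLLC.t2Space [IsTopologicalAddGroup V] (hV : IsLLC K V) : T2Space V := by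
  suffices T1Space V from inferInstance
  refine IsTopologicalAddGroup.t1Space V ?_
  obtain ⟨U, hU, -⟩ := hV.mem_iff.1 univ_mem
  have := hU.2.t2
  have hUc : IsClosed (U : Set V) := AddSubgroup.isClosed_of_isOpen U.toAddSubgroup hU.1
  have h := hUc.isClosedEmbedding_subtypeVal.isClosedMap _ (isClosed_singleton (x := (0 : U)))
  simpa using h

lemma comap_subtype_mem_openLC [IsTopologicalAddGroup V] [ContinuousConstSMul K V]
    {U : Submodule K V} (hU : U ∈ openLC K V) {W : Submodule K V} (hW : IsClosed (W : Set V)) :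
    U.comap W.subtype ∈ openLC K W := by
  refine ⟨hU.1.preimage continuous_subtype_val, ?_⟩
  let f : U.comap W.subtype →ₗ[K] U := W.subtype.restrict (fun _ hx => hx)
  have hval : IsEmbedding ((↑) ∘ f : U.comap W.subtype → V) :=
    (IsEmbedding.subtypeVal (p := (· ∈ W))).comp
      (IsEmbedding.subtypeVal (p := (· ∈ U.comap W.subtype)))
  have hf : Continuous f :=
    (continuous_subtype_val.comp continuous_subtype_val).subtype_mk _
  refine hU.2.of_isClosedEmbedding (f := f) ⟨hval.of_comp hf continuous_subtype_val, ?_⟩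
  have : Set.range f = Subtype.val ⁻¹' (W : Set V) := by
    ext x
    constructor
    · rintro ⟨y, rfl⟩
      exact y.1.2
    · intro hx
      exact ⟨⟨⟨x.1, hx⟩, x.2⟩, rfl⟩
  rw [this]
  exact hW.preimage continuous_subtype_val

lemma map_mkQ_mem_openLC [IsTopologicalAddGroup V] [IsLinearTopology K V] {U : Submodule K V}
    (hU : U ∈ openLC K V) (W : Submodule K V) [T2Space (V ⧸ W)]
    [ContinuousConstSMul K (V ⧸ W)] : U.map W.mkQ ∈ openLC K (V ⧸ W) := by
  refine ⟨W.isOpenMap_mkQ _ hU.1, ?_⟩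
  refine hU.2.of_surjective (f := W.mkQ.restrict fun x hx => Submodule.mem_map_of_mem hx)
    ((W.continuous_mkQ.comp continuous_subtype_val).subtype_mk _) ?_
  rintro ⟨_, x, hx, rfl⟩
  exact ⟨⟨x, hx⟩, rfl⟩

end LLC

/-- Any `U` is the kernel of a projection that preserves `W`. -/
lemma exists_projection {K : Type*} [Field K] {V : Type*} [AddCommGroup V] [Module K V]
    (U W : Submodule K V) :
    ∃ (C : Submodule K V) (p : V →ₗ[K] C), p ∘ₗ C.subtype = LinearMap.id ∧
      LinearMap.ker p = U ∧ ∀ w ∈ W, (p w : V) ∈ W := by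
  -- A complement of `U ∩ W` in `W` is enlarged to a complement `C` of `U`, so `p` sends `w` to its
  -- component in `D`.
  obtain ⟨D, hD⟩ := Submodule.exists_isCompl (U.submoduleOf W)
  have hdisj : Disjoint U (D.map W.subtype) := by
    rw [Submodule.disjoint_def]
    rintro _ hx ⟨y, hy, rfl⟩
    rw [Submodule.disjoint_def.1 hD.disjoint y hx hy, map_zero]
  obtain ⟨C, hDC, hC⟩ := hdisj.symm.exists_isCompl
  refine ⟨C, C.projectionOnto U hC, ?_, Submodule.ker_projectionOnto hC, ?_⟩
  · ext c
    simp
  · intro w hw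
    have : (⟨w, hw⟩ : W) ∈ U.submoduleOf W ⊔ D := hD.sup_eq_top ▸ Submodule.mem_top
    obtain ⟨u, hu, d, hd, hud⟩ := Submodule.mem_sup.1 this
    have hw' : w = u.1 + d.1 := (congrArg Subtype.val hud).symm
    have hdC : d.1 ∈ C := hDC ⟨d, hd, rfl⟩
    rw [hw', map_add, Submodule.projectionOnto_apply_of_mem_right hC (show u.1 ∈ U from hu), zero_add]
    rw [Submodule.projectionOnto_apply_of_mem_left hC hdC]
    exact d.2

end LinTop

/-- Addition Theorem for the algebraic entropy. -/
theorem mainTheorem6 {K : Type*} [Field K] [TopologicalSpace K] [DiscreteTopology K]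
    {V : Type*} [AddCommGroup V] [Module K V] [TopologicalSpace V]
    [IsTopologicalAddGroup V] [ContinuousSMul K V] (hV : LinTop.IsLLC K V)
    (φ : V →L[K] V) (W : Submodule K V) (hW : IsClosed (W : Set V))
    (hφW : ∀ w ∈ W, φ.toLinearMap w ∈ W) :
    LinTop.ent φ.toLinearMap =
      LinTop.ent (φ.toLinearMap.restrict hφW) + LinTop.ent (W.mapQ W φ.toLinearMap hφW) := by
  have := hV.isLinearTopology
  have := hV.t2Space
  obtain ⟨U, hU, -⟩ := hV.mem_iff.1 univ_mem
  obtain ⟨C, p, hp, rfl, hpW⟩ := LinTop.exists_projection U W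
  have hp' : ∀ c : C, p c = c := fun c => LinearMap.congr_fun hp c
  let ψ := p ∘ₗ φ.toLinearMap ∘ₗ C.subtype
  let E : Submodule K C := W.comap C.subtype
  have hE : ∀ c ∈ E, ψ c ∈ E := fun c hc => hpW _ (hφW _ hc)
  have hpE : W ≤ E.comap p := hpW
  have hW' : LinTop.ent (φ.toLinearMap.restrict hφW) =
      (Cardinal.toENat (Module.rank (Polynomial K) (Module.AEval' (ψ.restrict hE))) : ℝ≥0∞) :=
    LinTop.ent_eq_rank (p := p.restrict (q := E) hpW)
      (i := C.subtype.restrict (p := E) (q := W) fun _ hc => hc)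
      ((φ.continuous.comp continuous_subtype_val).subtype_mk _)
      (LinearMap.ext fun c => Subtype.ext (hp' c.1)) (by
        convert LinTop.comap_subtype_mem_openLC hU hW using 1
        ext w
        exact Subtype.ext_iff)
  have hVW : LinTop.ent (W.mapQ W φ.toLinearMap hφW) =
      (Cardinal.toENat (Module.rank (Polynomial K) (Module.AEval' (E.mapQ E ψ hE))) : ℝ≥0∞) := by
    have hcomp : W.mapQ E p hpE ∘ₗ W.mapQ W φ.toLinearMap hφW ∘ₗ E.mapQ W C.subtype le_rfl =
        E.mapQ E ψ hE := Submodule.linearMap_qext _ rfl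
    rw [← hcomp]
    refine LinTop.ent_eq_rank ?_ ?_ ?_
    · refine W.isQuotientMap_mkQ.continuous_iff.2 ?_
      exact W.continuous_mkQ.comp φ.continuous
    · refine Submodule.linearMap_qext _ (LinearMap.ext fun c => ?_)
      exact congrArg E.mkQ (hp' c)
    · convert LinTop.map_mkQ_mem_openLC hU W using 1
      rw [Submodule.ker_mapQ]
      apply le_antisymm
      · rintro _ ⟨x, hx, rfl⟩
        -- Since `p x ∈ W`, the class of `x` is that of `x - p x ∈ ker p`.
        refine ⟨x - p x, by simp [hp'], ?_⟩
        have : W.mkQ (p x : V) = 0 := (Submodule.Quotient.mk_eq_zero W).2 hx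
        rw [map_sub, this, sub_zero]
      · refine Submodule.map_mono fun x hx => ?_
        rw [Submodule.mem_comap, LinearMap.mem_ker.1 hx]
        exact E.zero_mem
  rw [LinTop.ent_eq_rank φ.continuous hp hU, hW', hVW,
    LinTop.rank_aeval_restrict_add_rank_aeval_mapQ ψ E hE, map_add, ENat.toENNReal_add, add_comm]
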